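/- Let $R$ be a square in the plane, and for each $n$ let $R_n$ be a set of $n$ points chosen independently and uniformly at random from $R$. A \emph{convex hole} of a point set $P$ is a convex polygon with vertices in $P$ that contains no point of $P$ in its interior; its \emph{size} is its number of vertices. Then, for any positive integer $s$, which may depend on $n$, the number of convex holes of $R_n$ of size $s$ is w.h.p. at most $n^9$. That is, for every sequence $(s_n)_{n\ge 1}$ of positive integers, $$\lim_{n\to\infty}\Pr\bigl(\text{the number of convex holes of } R_n \text{ of size } s_n \text{ is at most } n^9\bigr)=1 .$$ (In particular, this holds for every fixed $s$.) -/

import Mathlib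

open MeasureTheory ProbabilityTheory Filter Topology

/-- The Euclidean plane. -/
abbrev Plane : Type := EuclideanSpace ℝ (Fin 2)

/-- `R` is a (solid, nondegenerate) square in the plane, in arbitrary position: `a` is one of its
corners, and `u`, `v` are the two side vectors at that corner. -/
def IsPlanarSquare (R : Set Plane) : Prop :=
  ∃ a u v : Plane, u ≠ 0 ∧ ‖u‖ = ‖v‖ ∧ inner ℝ u v = 0 ∧
    R = {p | ∃ x ∈ Set.Icc (0 : ℝ) 1, ∃ y ∈ Set.Icc (0 : ℝ) 1, p = a + x • u + y • v}

/-- The law of `n` independent points, each uniformly distributed over the region `R`. -/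
noncomputable def uniformPoints (R : Set Plane) (n : ℕ) : Measure (Fin n → Plane) :=
  Measure.pi fun _ => ProbabilityTheory.cond volume R

/-- `V` is the vertex set of a convex hole of the point set `P`: the points of `V` belong to `P`,
they are in convex position (so that `V` is exactly the vertex set of the convex polygon
`convexHull ℝ V`), and the interior of this polygon contains no point of `P`. A convex polygon is
determined by its vertex set, and its size is the number of its vertices. (Vertex sets with one
or two points, that is points and segments, are not excluded.) -/
def IsConvexHole (P : Set Plane) (V : Finset Plane) : Prop :=
  (V : Set Plane) ⊆ P ∧
    ConvexIndependent ℝ (Subtype.val : {x // x ∈ V} → Plane) ∧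
    Disjoint (interior (convexHull ℝ (V : Set Plane))) P

/-- The number of convex holes of size `s` of the point set `P`. It is used for finite `P`
only, for which the set that is counted is finite. -/
noncomputable def numConvexHoles (P : Set Plane) (s : ℕ) : ℕ :=
  Set.ncard {V : Finset Plane | IsConvexHole P V ∧ V.card = s}

/-- The events `E n` hold with high probability: the probability that `E n` fails tends to `0`
as `n → ∞`. -/
def WithHighProbability {Ω : ℕ → Type*} [∀ n, MeasurableSpace (Ω n)]
    (μ : ∀ n, Measure (Ω n)) (E : ∀ n, Set (Ω n)) : Prop :=
  Tendsto (fun n => μ n (E n)ᶜ) atTop (𝓝 0)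

/-! The expected number of holes of size `s` is at most `n ^ 4`, so Markov's inequality leaves ample
room below `n ^ 9`. In a hole take a leftmost vertex `a`, a rightmost vertex `b`, and vertices `c`,
`d` extremal above and below the line `a b`. The open triangles `a b c` and `a b d` lie in the
interior of the hole, hence contain no point, while all vertices lie in two parallelograms on `a b`
of twice the area of these triangles.

Fix the indices `q` of the four extreme points and the set `S` of the other indices of vertices.
Outside the triangles, the room left for the points of `S` has measure at most that of the triangles
(`cond_outerParallelogram_diff_le`). So this configuration is at most as likely as the event that
the points inside the triangles are exactly those of `S`. For fixed `q` the latter events are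
disjoint as `S` varies, so the probabilities sum to at most 1 (`sum_candidateEvent_le_one`), and
there are `n ^ 4` choices of `q`. -/

/-! ### Triangles and parallelograms over a segment -/

/-- The cross product of `b - a` and `p - a`. -/
def planeCross (a b p : Plane) : ℝ := (b 0 - a 0) * (p 1 - a 1) - (b 1 - a 1) * (p 0 - a 0)

/-- The open triangle `a b c`, where `c` is on the side of the line `a b` given by the sign of `σ`
and its first coordinate is between those of `a` and `b`. -/
def openTriangle (σ : ℝ) (a b c : Plane) : Set Plane :=
  {p | 0 < σ * planeCross a b p ∧
    0 < σ * planeCross a b c * (p 0 - a 0) - (c 0 - a 0) * (σ * planeCross a b p) ∧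
    0 < σ * planeCross a b c * (b 0 - p 0) - (b 0 - c 0) * (σ * planeCross a b p)}

/-- The parallelogram with side `a b` and two vertical sides, whose side opposite to `a b` passes
through `c`; it is empty when `c` is not in the right position with respect to `a` and `b`. -/
def verticalParallelogram (σ : ℝ) (a b c : Plane) : Set Plane :=
  {p | (a 0 ≤ c 0 ∧ c 0 ≤ b 0) ∧ (a 0 ≤ p 0 ∧ p 0 ≤ b 0) ∧
    0 ≤ σ * planeCross a b p ∧ σ * planeCross a b p ≤ σ * planeCross a b c}

theorem volume_line_eq_zero {α β : ℝ} (γ : ℝ) (h : α ≠ 0 ∨ β ≠ 0) :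
    volume {p : Plane | α * p 0 + β * p 1 = γ} = 0 := by
  let L : AffineSubspace ℝ Plane :=
    { carrier := {p : Plane | α * p 0 + β * p 1 = γ}
      smul_vsub_vadd_mem' := by
        intro t p q r hp hq hr
        simp only [Set.mem_ofPred_eq, vsub_eq_sub, vadd_eq_add, PiLp.add_apply, PiLp.smul_apply,
          PiLp.sub_apply, smul_eq_mul] at *
        linear_combination t * hp - t * hq + hr }
  refine Measure.addHaar_affineSubspace volume L fun hL => ?_
  have mem (p : Plane) : α * p 0 + β * p 1 = γ := by
    have : p ∈ L := by rw [hL]; trivial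
    exact this
  have h0 := mem 0
  have h1 := mem !₂[1, 0]
  have h2 := mem !₂[0, 1]
  simp at h0 h1 h2
  rcases h with h | h <;> apply h <;> linarith

@[fun_prop]
theorem continuous_planeCross {X : Type*} [TopologicalSpace X] {a b p : X → Plane}
    (ha : Continuous a) (hb : Continuous b) (hp : Continuous p) :
    Continuous fun x => planeCross (a x) (b x) (p x) := by
  unfold planeCross
  fun_prop

theorem isOpen_openTriangle_preimage {X : Type*} [TopologicalSpace X] (σ : ℝ)
    {a b c p : X → Plane} (ha : Continuous a) (hb : Continuous b) (hc : Continuous c)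
    (hp : Continuous p) : IsOpen {x | p x ∈ openTriangle σ (a x) (b x) (c x)} := by
  refine (isOpen_lt (α := ℝ) (f := fun _ => 0) ?_ ?_).inter
    ((isOpen_lt (α := ℝ) (f := fun _ => 0) ?_ ?_).inter
      (isOpen_lt (α := ℝ) (f := fun _ => 0) ?_ ?_)) <;> fun_prop

theorem isOpen_openTriangle (σ : ℝ) (a b c : Plane) : IsOpen (openTriangle σ a b c) :=
  isOpen_openTriangle_preimage σ continuous_const continuous_const continuous_const continuous_id

theorem isClosed_verticalParallelogram_preimage {X : Type*} [TopologicalSpace X] (σ : ℝ)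
    {a b c p : X → Plane} (ha : Continuous a) (hb : Continuous b) (hc : Continuous c)
    (hp : Continuous p) : IsClosed {x | p x ∈ verticalParallelogram σ (a x) (b x) (c x)} := by
  simp only [verticalParallelogram, Set.ofPred_and]
  refine IsClosed.inter (IsClosed.inter ?_ ?_)
    (IsClosed.inter (IsClosed.inter ?_ ?_) (IsClosed.inter ?_ ?_)) <;>
    exact isClosed_le (by fun_prop) (by fun_prop)

theorem openTriangle_subset_convexHull {σ : ℝ} {a b c : Plane} (hac : a 0 ≤ c 0)
    (hcb : c 0 ≤ b 0) : openTriangle σ a b c ⊆ convexHull ℝ {a, b, c} := by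
  rintro p ⟨h1, h2, h3⟩
  set F := σ * planeCross a b p with hF
  set G := σ * planeCross a b c with hG
  have hD : 0 < G * (b 0 - a 0) := by nlinarith
  have hG0 : 0 < G := by
    by_contra hcon
    nlinarith
  have hD0 : 0 < b 0 - a 0 := pos_of_mul_pos_right hD hG0.le
  -- Barycentric coordinates: up to positive factors, they are the three quantities required to be
  -- positive in `openTriangle`.
  have hp : p = ∑ i : Fin 3, ![(G * (b 0 - p 0) - (b 0 - c 0) * F) / (G * (b 0 - a 0)),
      (G * (p 0 - a 0) - (c 0 - a 0) * F) / (G * (b 0 - a 0)), F / G] i • ![a, b, c] i := by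
    have key : F * planeCross a b c = G * planeCross a b p := by
      rw [hF, hG]
      ring
    unfold planeCross at key
    ext i
    fin_cases i
    · simp [Fin.sum_univ_three]
      field_simp
      ring
    · simp [Fin.sum_univ_three]
      field_simp
      linear_combination -key
  rw [hp]
  refine (convex_convexHull ℝ _).sum_mem ?_ ?_ ?_
  · intro i _
    fin_cases i
    exacts [(div_pos h3 hD).le, (div_pos h2 hD).le, (div_pos h1 hG0).le]
  · simp only [Fin.sum_univ_three, Matrix.cons_val]
    field_simp
    ring
  · intro i _
    apply subset_convexHull
    fin_cases i <;> simp

theorem disjoint_openTriangle (a b c d : Plane) :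
    Disjoint (openTriangle 1 a b c) (openTriangle (-1) a b d) := by
  rw [Set.disjoint_left]
  rintro p ⟨h1, -⟩ ⟨h2, -⟩
  linarith

/-- The vertical line through `c` cuts the parallelogram into two, with diagonals `a c` and `b c`.
The point reflections in the midpoints of these diagonals carry the part outside the triangle into
the triangle, up to null sets. -/
theorem volume_verticalParallelogram_diff_openTriangle_le {σ : ℝ} (hσ : σ ≠ 0) (a b c : Plane) :
    volume (verticalParallelogram σ a b c \ openTriangle σ a b c)
      ≤ volume (openTriangle σ a b c) := by
  by_cases hc : a 0 ≤ c 0 ∧ c 0 ≤ b 0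
  swap
  · have : verticalParallelogram σ a b c = ∅ := by
      ext p
      simp only [verticalParallelogram, Set.mem_ofPred_eq, Set.mem_empty_iff_false, iff_false]
      tauto
    simp [this]
  obtain ⟨hac, hcb⟩ := hc
  rcases (hac.trans hcb).eq_or_lt with hab | hab
  · refine (measure_mono_null ?_ (volume_line_eq_zero (a 0)
      (Or.inl one_ne_zero : _ ∨ (0 : ℝ) ≠ 0))).le.trans zero_le
    rintro p ⟨⟨-, ⟨h1, h2⟩, -⟩, -⟩
    simp only [Set.mem_ofPred_eq]
    linarith
  have hcrossline (γ : ℝ) : volume {p : Plane | planeCross a b p = γ} = 0 := by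
    refine measure_mono_null ?_ (volume_line_eq_zero (α := -(b 1 - a 1)) (β := b 0 - a 0)
      (γ + (b 0 - a 0) * a 1 - (b 1 - a 1) * a 0) (Or.inr (sub_ne_zero.2 hab.ne')))
    intro p hp
    simp only [Set.mem_ofPred_eq, planeCross] at *
    linarith
  rcases le_or_gt (σ * planeCross a b c) 0 with hG | hG
  · refine (measure_mono_null ?_ (hcrossline 0)).le.trans zero_le
    rintro p ⟨⟨-, -, h1, h2⟩, -⟩
    have : σ * planeCross a b p = 0 := by linarith
    simpa [hσ] using this
  have hvert (x : ℝ) : volume {p : Plane | p 0 = x} = 0 := by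
    simpa using volume_line_eq_zero x (Or.inl one_ne_zero : (1 : ℝ) ≠ 0 ∨ (0 : ℝ) ≠ 0)
  set G := σ * planeCross a b c with hGdef
  -- The line `a c` is vertical when `a 0 = c 0`, and then the coefficient of `p 1` vanishes; hence
  -- the case split.
  have hca : volume {p : Plane | G * (p 0 - a 0) - (c 0 - a 0) * (σ * planeCross a b p) = 0}
      = 0 := by
    rcases hac.eq_or_lt with h | h
    · refine measure_mono_null ?_ (hvert (a 0))
      intro p hp
      simp only [Set.mem_ofPred_eq, h, sub_self, zero_mul, sub_zero, mul_eq_zero, hG.ne',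
        false_or] at *
      linarith
    · refine measure_mono_null ?_ (volume_line_eq_zero
        (α := G + (c 0 - a 0) * σ * (b 1 - a 1)) (β := -((c 0 - a 0) * σ * (b 0 - a 0)))
        (G * a 0 - (c 0 - a 0) * σ * ((b 0 - a 0) * a 1 - (b 1 - a 1) * a 0)) (Or.inr ?_))
      · intro p hp
        simp only [Set.mem_ofPred_eq, planeCross] at *
        linarith
      · have h1 := sub_ne_zero.2 h.ne'
        have h2 := sub_ne_zero.2 hab.ne'
        simp [h1, h2, hσ]
  have hcb' : volume {p : Plane | G * (b 0 - p 0) - (b 0 - c 0) * (σ * planeCross a b p) = 0}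
      = 0 := by
    rcases hcb.eq_or_lt with h | h
    · refine measure_mono_null ?_ (hvert (b 0))
      intro p hp
      simp only [Set.mem_ofPred_eq, h, sub_self, zero_mul, sub_zero, mul_eq_zero, hG.ne',
        false_or] at *
      linarith
    · refine measure_mono_null ?_ (volume_line_eq_zero
        (α := -G + (b 0 - c 0) * σ * (b 1 - a 1)) (β := -((b 0 - c 0) * σ * (b 0 - a 0)))
        (-G * b 0 - (b 0 - c 0) * σ * ((b 0 - a 0) * a 1 - (b 1 - a 1) * a 0)) (Or.inr ?_))
      · intro p hp
        simp only [Set.mem_ofPred_eq, planeCross] at *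
        linarith
      · have h1 := sub_ne_zero.2 h.ne'
        have h2 := sub_ne_zero.2 hab.ne'
        simp [h1, h2, hσ]
  set T := openTriangle σ a b c with hT
  have hTm : MeasurableSet T := (isOpen_openTriangle σ a b c).measurableSet
  have hlt : MeasurableSet {p : Plane | p 0 < c 0} :=
    (isOpen_lt (by fun_prop) (by fun_prop)).measurableSet
  -- Off these finitely many lines all weak inequalities become strict, as the open triangle
  -- demands.
  have hnull : ∀ᵐ p : Plane, p 0 ≠ a 0 ∧ p 0 ≠ b 0 ∧ p 0 ≠ c 0 ∧ planeCross a b p ≠ 0 ∧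
      planeCross a b p ≠ planeCross a b c ∧
      G * (p 0 - a 0) - (c 0 - a 0) * (σ * planeCross a b p) ≠ 0 ∧
      G * (b 0 - p 0) - (b 0 - c 0) * (σ * planeCross a b p) ≠ 0 := by
    simp only [eventually_and]
    refine ⟨?_, ?_, ?_, ?_, ?_, ?_, ?_⟩ <;>
      simp only [ae_iff, not_not, hvert, hcrossline, hca, hcb', ne_eq]
  have hsub : (verticalParallelogram σ a b c \ T : Set Plane) ≤ᵐ[volume]
      ((fun p => (a + c) - p) ⁻¹' (T ∩ {p | p 0 < c 0}) ∪
        (fun p => (b + c) - p) ⁻¹' (T \ {p | p 0 < c 0}) : Set Plane) := by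
    filter_upwards [hnull] with p ⟨n1, n2, n3, n4, n5, n6, n7⟩ hp
    have n4' : σ * planeCross a b p ≠ 0 := mul_ne_zero hσ n4
    have n5' : σ * planeCross a b p ≠ G := fun h => n5 (mul_left_cancel₀ hσ h)
    obtain ⟨⟨-, ⟨h1, h2⟩, h3, h4⟩, h5⟩ := hp
    have e1 : σ * planeCross a b (a + c - p) = G - σ * planeCross a b p := by
      simp only [hGdef, planeCross, PiLp.add_apply, PiLp.sub_apply]
      ring
    have e2 : σ * planeCross a b (b + c - p) = G - σ * planeCross a b p := by
      simp only [hGdef, planeCross, PiLp.add_apply, PiLp.sub_apply]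
      ring
    simp only [hT, openTriangle, Set.mem_ofPred_eq, not_and, ← hGdef, not_lt] at h5
    change (_ ∧ _) ∨ (_ ∧ ¬ _)
    simp only [hT, openTriangle, Set.mem_ofPred_eq, e1, e2, ← hGdef, PiLp.add_apply,
      PiLp.sub_apply]
    rw [← hGdef] at h4
    set F := σ * planeCross a b p
    replace h1 := lt_of_le_of_ne h1 n1.symm
    replace h2 := lt_of_le_of_ne h2 n2
    replace h3 := lt_of_le_of_ne h3 n4'.symm
    replace h4 := lt_of_le_of_ne h4 n5'
    rcases lt_or_gt_of_ne n3 with h6 | h6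
    · left
      -- To the left of `c` and below its level, the side `b c` imposes no restriction, so `p` must
      -- be beyond `a c`.
      have h7 : G * (p 0 - a 0) - (c 0 - a 0) * F < 0 := by
        refine lt_of_le_of_ne ?_ n6
        by_contra! hcon
        have := h5 h3 hcon
        nlinarith
      refine ⟨⟨?_, ?_, ?_⟩, ?_⟩ <;> nlinarith
    · right
      have h7 : G * (b 0 - p 0) - (b 0 - c 0) * F < 0 := by
        refine lt_of_le_of_ne (h5 h3 ?_) n7
        nlinarith
      refine ⟨⟨?_, ?_, ?_⟩, ?_⟩ <;> nlinarith
  calc _ ≤ _ := measure_mono_ae hsub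
    _ ≤ _ := measure_union_le _ _
    _ = volume (T ∩ {p | p 0 < c 0}) + volume (T \ {p | p 0 < c 0}) := by
      rw [(Measure.measurePreserving_sub_left volume (a + c)).measure_preimage
        (hTm.inter hlt).nullMeasurableSet,
        (Measure.measurePreserving_sub_left volume (b + c)).measure_preimage
        (hTm.diff hlt).nullMeasurableSet]
    _ = volume T := measure_inter_add_sdiff _ hlt

/-! ### The two regions determined by four points -/

/-- The union of the two open triangles with common side `v 0`, `v 1` and apexes `v 2` (above)
and `v 3` (below). -/
def innerTriangles (v : Fin 4 → Plane) : Set Plane :=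
  openTriangle 1 (v 0) (v 1) (v 2) ∪ openTriangle (-1) (v 0) (v 1) (v 3)

/-- The parallelogram with two vertical sides through `v 0` and `v 1` and two sides parallel to
`v 0`, `v 1` through `v 2` and `v 3`; it is empty unless all the points `v i` are in `R`. -/
def outerParallelogram (R : Set Plane) (v : Fin 4 → Plane) : Set Plane :=
  {p | (∀ i, v i ∈ R) ∧
    p ∈ verticalParallelogram 1 (v 0) (v 1) (v 2) ∪ verticalParallelogram (-1) (v 0) (v 1) (v 3)}

theorem isOpen_innerTriangles (v : Fin 4 → Plane) : IsOpen (innerTriangles v) :=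
  (isOpen_openTriangle _ _ _ _).union (isOpen_openTriangle _ _ _ _)

theorem measurableSet_innerTriangles :
    MeasurableSet {z : (Fin 4 → Plane) × Plane | z.2 ∈ innerTriangles z.1} := by
  refine IsOpen.measurableSet (IsOpen.union ?_ ?_) <;>
    exact isOpen_openTriangle_preimage _ (by fun_prop) (by fun_prop) (by fun_prop) (by fun_prop)

theorem measurableSet_outerParallelogram {R : Set Plane} (hR : MeasurableSet R) :
    MeasurableSet {z : (Fin 4 → Plane) × Plane | z.2 ∈ outerParallelogram R z.1} := by
  refine MeasurableSet.inter ?_ (MeasurableSet.union ?_ ?_)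
  · have : MeasurableSet (⋂ i, {z : (Fin 4 → Plane) × Plane | z.1 i ∈ R}) :=
      MeasurableSet.iInter fun i => measurableSet_preimage (by fun_prop) hR
    rwa [← Set.ofPred_forall] at this
  all_goals
    exact (isClosed_verticalParallelogram_preimage _ (by fun_prop) (by fun_prop) (by fun_prop)
      (by fun_prop)).measurableSet

/-- Convexity keeps the triangle inside `R`, so restricting to `R` can only shrink the left side. -/
theorem cond_verticalParallelogram_diff_le {R : Set Plane} (hR : MeasurableSet R)
    (hconv : Convex ℝ R) {σ : ℝ} (hσ : σ ≠ 0) {a b c : Plane} (ha : a ∈ R) (hb : b ∈ R)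
    (hc : c ∈ R) :
    cond volume R (verticalParallelogram σ a b c \ openTriangle σ a b c)
      ≤ cond volume R (openTriangle σ a b c) := by
  by_cases h : a 0 ≤ c 0 ∧ c 0 ≤ b 0
  · have hsub : openTriangle σ a b c ⊆ R :=
      (openTriangle_subset_convexHull h.1 h.2).trans (convexHull_min (by
        rintro p (rfl | rfl | rfl) <;> assumption) hconv)
    rw [cond_apply hR, cond_apply hR, Set.inter_eq_self_of_subset_right hsub]
    refine mul_le_mul_right ?_ _
    exact (measure_mono Set.inter_subset_right).trans
      (volume_verticalParallelogram_diff_openTriangle_le hσ a b c)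
  · have : verticalParallelogram σ a b c = ∅ :=
      Set.eq_empty_of_forall_notMem fun p hp => h hp.1
    simp [this]

theorem cond_outerParallelogram_diff_le {R : Set Plane} (hR : MeasurableSet R)
    (hconv : Convex ℝ R) (v : Fin 4 → Plane) :
    cond volume R (outerParallelogram R v \ innerTriangles v)
      ≤ cond volume R (innerTriangles v) := by
  by_cases hv : ∀ i, v i ∈ R
  swap
  · have : outerParallelogram R v = ∅ := Set.eq_empty_of_forall_notMem fun p hp => hv hp.1
    simp [this]
  calc _ ≤ cond volume R
        ((verticalParallelogram 1 (v 0) (v 1) (v 2) \ openTriangle 1 (v 0) (v 1) (v 2)) ∪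
        (verticalParallelogram (-1) (v 0) (v 1) (v 3) \ openTriangle (-1) (v 0) (v 1) (v 3))) := by
        refine measure_mono ?_
        rintro p ⟨⟨-, h | h⟩, h'⟩
        · exact Or.inl ⟨h, fun h1 => h' (Or.inl h1)⟩
        · exact Or.inr ⟨h, fun h1 => h' (Or.inr h1)⟩
    _ ≤ _ := measure_union_le _ _
    _ ≤ cond volume R (openTriangle 1 (v 0) (v 1) (v 2))
          + cond volume R (openTriangle (-1) (v 0) (v 1) (v 3)) :=
        add_le_add
          (cond_verticalParallelogram_diff_le hR hconv one_ne_zero (hv 0) (hv 1) (hv 2))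
          (cond_verticalParallelogram_diff_le hR hconv (by norm_num) (hv 0) (hv 1) (hv 3))
    _ = _ := (measure_union (disjoint_openTriangle _ _ _ _)
        (isOpen_openTriangle _ _ _ _).measurableSet).symm

/-! ### Comparison of events given some coordinates -/

section Pi

variable {X ι : Type*} [MeasurableSpace X] [Fintype ι] (μ : Measure X) [IsProbabilityMeasure μ]
  (K : Finset ι)

theorem measurableSet_forall_notMem {A : ({i // i ∈ K} → X) → ι → Set X}
    (hA : ∀ i, MeasurableSet {z : ({i // i ∈ K} → X) × X | z.2 ∈ A z.1 i}) :
    MeasurableSet {p : ι → X | ∀ i ∉ K, p i ∈ A (fun j => p j) i} := by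
  simp only [Set.ofPred_forall]
  exact MeasurableSet.iInter fun i => MeasurableSet.iInter fun _ =>
    measurableSet_preimage (f := fun p : ι → X => ((fun j : {i // i ∈ K} => p j), p i))
      (by fun_prop) (hA i)

theorem pi_forall_notMem_eq_lintegral [DecidableEq ι] {A : ({i // i ∈ K} → X) → ι → Set X}
    (hA : ∀ i, MeasurableSet {z : ({i // i ∈ K} → X) × X | z.2 ∈ A z.1 i}) :
    Measure.pi (fun _ : ι => μ) {p | ∀ i ∉ K, p i ∈ A (fun j => p j) i}
      = ∫⁻ x, ∏ i : {i // i ∉ K}, μ (A x i) ∂Measure.pi (fun _ : {i // i ∈ K} => μ) := by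
  have hmp := measurePreserving_piEquivPiSubtypeProd (fun _ : ι => μ) (fun i => i ∈ K)
  have hset : {p : ι → X | ∀ i ∉ K, p i ∈ A (fun j => p j) i}
      = MeasurableEquiv.piEquivPiSubtypeProd (fun _ : ι => X) (fun i => i ∈ K) ⁻¹'
        {z | ∀ i : {i // i ∉ K}, z.2 i ∈ A z.1 i} := by
    ext p
    simp [MeasurableEquiv.piEquivPiSubtypeProd, Equiv.piEquivPiSubtypeProd]
  have hm : MeasurableSet {z : ({i // i ∈ K} → X) × ({i // i ∉ K} → X) |
      ∀ i : {i // i ∉ K}, z.2 i ∈ A z.1 i} := by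
    simp only [Set.ofPred_forall]
    exact MeasurableSet.iInter fun i => measurableSet_preimage
      (f := fun z : ({i // i ∈ K} → X) × ({i // i ∉ K} → X) => (z.1, z.2 i)) (by fun_prop) (hA i)
  rw [hset, hmp.measure_preimage_equiv, Measure.prod_apply hm]
  convert lintegral_congr fun x => ?_ using 3
  rw [← Measure.pi_pi]
  congr 1
  ext y
  simp

/-- Given the coordinates in `K`, the others are still independent, so by Fubini it is enough to
compare coordinate by coordinate. -/
theorem pi_forall_notMem_le [DecidableEq ι] {A B : ({i // i ∈ K} → X) → ι → Set X}
    (hA : ∀ i, MeasurableSet {z : ({i // i ∈ K} → X) × X | z.2 ∈ A z.1 i})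
    (hB : ∀ i, MeasurableSet {z : ({i // i ∈ K} → X) × X | z.2 ∈ B z.1 i})
    (h : ∀ x i, μ (A x i) ≤ μ (B x i)) :
    Measure.pi (fun _ : ι => μ) {p | ∀ i ∉ K, p i ∈ A (fun j => p j) i}
      ≤ Measure.pi (fun _ : ι => μ) {p | ∀ i ∉ K, p i ∈ B (fun j => p j) i} := by
  rw [pi_forall_notMem_eq_lintegral μ K hA, pi_forall_notMem_eq_lintegral μ K hB]
  exact lintegral_mono fun x => Finset.prod_le_prod' fun i _ => h x i

end Pi

/-! ### Candidate holes -/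

/-- Given the points `x` with indices `q`, the region of the point with index `i`: the outer
parallelogram without the inner triangles if `i ∈ S`, and the complement of the inner triangles
otherwise. -/
def candidateRegion (R : Set Plane) {n : ℕ} (q : Fin 4 → Fin n) (S : Finset (Fin n))
    (x : {i // i ∈ Finset.univ.image q} → Plane) (i : Fin n) : Set Plane :=
  if i ∈ S then outerParallelogram R (fun j => x ⟨q j, by simp⟩) \
    innerTriangles (fun j => x ⟨q j, by simp⟩)
  else (innerTriangles (fun j => x ⟨q j, by simp⟩))ᶜ

/-- The points of `p` with indices in `S` are in the outer parallelogram of the points with indices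
`q`, and these and all the remaining points of `p` are outside of the inner triangles. -/
def candidateEvent (R : Set Plane) {n : ℕ} (q : Fin 4 → Fin n) (S : Finset (Fin n)) :
    Set (Fin n → Plane) :=
  {p | ∀ i ∉ Finset.univ.image q, p i ∈ candidateRegion R q S (fun j => p j) i}

section Candidates

variable {R : Set Plane} (hR : MeasurableSet R) {n : ℕ} (q : Fin 4 → Fin n)
include hR

theorem measurableSet_candidateRegion (S : Finset (Fin n)) (i : Fin n) :
    MeasurableSet {z : ({i // i ∈ Finset.univ.image q} → Plane) × Plane |
      z.2 ∈ candidateRegion R q S z.1 i} := by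
  have hf : Measurable fun z : ({i // i ∈ Finset.univ.image q} → Plane) × Plane =>
      ((fun j => z.1 ⟨q j, by simp⟩ : Fin 4 → Plane), z.2) := by fun_prop
  have h1 := measurableSet_preimage hf measurableSet_innerTriangles
  have h2 := measurableSet_preimage hf (measurableSet_outerParallelogram hR)
  simp only [candidateRegion]
  split_ifs
  · exact h2.diff h1
  · exact h1.compl

theorem measurableSet_candidateEvent (S : Finset (Fin n)) :
    MeasurableSet (candidateEvent R q S) :=
  measurableSet_forall_notMem _ (measurableSet_candidateRegion hR q S)

/-- Replacing the outer region by the inner triangles for the indices in `S` does not decrease the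
probability, and makes the events disjoint. -/
theorem sum_candidateEvent_le_one (hconv : Convex ℝ R) (h0 : volume R ≠ 0) (h1 : volume R ≠ ⊤)
    (m : ℕ) :
    ∑ S ∈ (Finset.univ \ Finset.univ.image q).powersetCard m,
      uniformPoints R n (candidateEvent R q S) ≤ 1 := by
  have : IsProbabilityMeasure (cond volume R) := cond_isProbabilityMeasure_of_finite h0 h1
  have : IsProbabilityMeasure (uniformPoints R n) := by
    unfold uniformPoints
    infer_instance
  let B (S : Finset (Fin n)) (x : {i // i ∈ Finset.univ.image q} → Plane) (i : Fin n) :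
      Set Plane :=
    if i ∈ S then innerTriangles (fun j => x ⟨q j, by simp⟩)
    else (innerTriangles (fun j => x ⟨q j, by simp⟩))ᶜ
  have hB (S : Finset (Fin n)) (i : Fin n) :
      MeasurableSet {z : ({i // i ∈ Finset.univ.image q} → Plane) × Plane | z.2 ∈ B S z.1 i} := by
    have hf : Measurable fun z : ({i // i ∈ Finset.univ.image q} → Plane) × Plane =>
        ((fun j => z.1 ⟨q j, by simp⟩ : Fin 4 → Plane), z.2) := by fun_prop
    have h1 := measurableSet_preimage hf measurableSet_innerTriangles
    simp only [B]
    split_ifs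
    · exact h1
    · exact h1.compl
  let F (S : Finset (Fin n)) : Set (Fin n → Plane) :=
    {p | ∀ i ∉ Finset.univ.image q, p i ∈ B S (fun j => p j) i}
  have hle (S : Finset (Fin n)) :
      uniformPoints R n (candidateEvent R q S) ≤ uniformPoints R n (F S) := by
    refine pi_forall_notMem_le _ _ (measurableSet_candidateRegion hR q S) (hB S) fun x i => ?_
    simp only [B, candidateRegion]
    split_ifs
    · exact cond_outerParallelogram_diff_le hR hconv _
    · exact le_rfl
  refine (Finset.sum_le_sum fun S _ => hle S).trans ?_
  rw [← measure_biUnion_finset]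
  · exact prob_le_one
  -- `S` is recovered from `p` as the set of indices outside the image of `q` whose points are in
  -- the inner triangles.
  · intro S hS S' hS' hne
    rw [Function.onFun, Set.disjoint_left]
    intro p hp hp'
    apply hne
    simp only [Finset.mem_coe, Finset.mem_powersetCard] at hS hS'
    ext i
    by_cases hi : i ∈ Finset.univ.image q
    · have h1 (h : i ∈ S) : False := (Finset.mem_sdiff.1 (hS.1 h)).2 hi
      have h2 (h : i ∈ S') : False := (Finset.mem_sdiff.1 (hS'.1 h)).2 hi
      tauto
    · have h1 := hp i hi
      have h2 := hp' i hi
      simp only [B] at h1 h2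
      split_ifs at h1 h2 with h3 h4 h4
      · simp [h3, h4]
      · exact absurd h1 h2
      · exact absurd h2 h1
      · simp [h3, h4]
  · exact fun S _ => measurableSet_forall_notMem _ (hB S)

end Candidates

/-- The pairs `(q, S)` that may give holes of size `s`. -/
def candidates (n s : ℕ) : Finset ((_ : Fin 4 → Fin n) × Finset (Fin n)) :=
  Finset.univ.sigma fun q =>
    (Finset.univ \ Finset.univ.image q).powersetCard (s - (Finset.univ.image q).card)

theorem IsConvexHole.exists_candidate {R : Set Plane} {n s : ℕ} (hs : 0 < s)
    {p : Fin n → Plane} (hp : ∀ i, p i ∈ R) {V : Finset Plane}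
    (hV : IsConvexHole (Set.range p) V) (hcard : V.card = s) :
    ∃ c ∈ candidates n s, p ∈ candidateEvent R c.1 c.2 ∧
      (c.2 ∪ Finset.univ.image c.1).image p = V := by
  obtain ⟨hVP, -, hdisj⟩ := hV
  have hne : V.Nonempty := Finset.card_pos.1 (hcard ▸ hs)
  obtain ⟨a, haV, ha⟩ := V.exists_min_image (fun x => x 0) hne
  obtain ⟨b, hbV, hb⟩ := V.exists_max_image (fun x => x 0) hne
  obtain ⟨c, hcV, hc⟩ := V.exists_max_image (fun x => planeCross a b x) hne
  obtain ⟨d, hdV, hd⟩ := V.exists_min_image (fun x => planeCross a b x) hne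
  obtain ⟨i₀, -⟩ := hVP haV
  have : Nonempty (Fin n) := ⟨i₀⟩
  choose! g hg using fun x (hx : x ∈ V) => hVP hx
  have hginj : Set.InjOn g V := fun x hx y hy h => by rw [← hg x hx, h, hg y hy]
  let v : Fin 4 → Plane := ![a, b, c, d]
  have hvV (j : Fin 4) : v j ∈ V := by fin_cases j <;> assumption
  let q : Fin 4 → Fin n := fun j => g (v j)
  have hpq : p ∘ q = v := funext fun j => hg _ (hvV j)
  have hqsub : Finset.univ.image q ⊆ V.image g := by
    intro i hi
    obtain ⟨j, -, rfl⟩ := Finset.mem_image.1 hi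
    exact Finset.mem_image_of_mem _ (hvV j)
  have hJ2 : innerTriangles v ⊆ convexHull ℝ (Set.range v) := by
    refine Set.union_subset ?_ ?_
    · refine (openTriangle_subset_convexHull (ha c hcV) (hb c hcV)).trans (convexHull_mono ?_)
      rintro x (rfl | rfl | rfl)
      exacts [⟨0, rfl⟩, ⟨1, rfl⟩, ⟨2, rfl⟩]
    · refine (openTriangle_subset_convexHull (ha d hdV) (hb d hdV)).trans (convexHull_mono ?_)
      rintro x (rfl | rfl | rfl)
      exacts [⟨0, rfl⟩, ⟨1, rfl⟩, ⟨3, rfl⟩]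
  have hrange : Set.range v ⊆ V := by
    rintro _ ⟨j, rfl⟩
    exact hvV j
  -- An open subset of the hull is in its interior, which contains no point.
  have hJ (i : Fin n) : p i ∉ innerTriangles v := by
    intro h
    exact Set.disjoint_left.1 hdisj (interior_maximal (hJ2.trans (convexHull_mono hrange))
      (isOpen_innerTriangles v) h) ⟨i, rfl⟩
  have hO (x : Plane) (hx : x ∈ V) : x ∈ outerParallelogram R v := by
    refine ⟨fun j => hpq ▸ hp _, ?_⟩
    rcases le_total 0 (planeCross a b x) with h | h
    · exact Or.inl ⟨⟨ha c hcV, hb c hcV⟩, ⟨ha x hx, hb x hx⟩, by simpa [v] using h,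
        by simpa [v] using hc x hx⟩
    · exact Or.inr ⟨⟨ha d hdV, hb d hdV⟩, ⟨ha x hx, hb x hx⟩, by simpa [v] using h,
        by simpa [v] using hd x hx⟩
  -- Extreme vertices may coincide, so `q` need not be injective; the size of `S` is therefore `s`
  -- minus the size of the image of `q`, not `s - 4`.
  refine ⟨⟨q, V.image g \ Finset.univ.image q⟩, ?_, ?_, ?_⟩
  · simp only [candidates, Finset.mem_sigma, Finset.mem_univ, true_and, Finset.mem_powersetCard]
    refine ⟨Finset.sdiff_subset_sdiff (Finset.subset_univ _) le_rfl, ?_⟩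
    rw [Finset.card_sdiff_of_subset hqsub, Finset.card_image_of_injOn hginj, hcard]
  · intro i hi
    change p i ∈ if i ∈ V.image g \ Finset.univ.image q then
      outerParallelogram R (p ∘ q) \ innerTriangles (p ∘ q) else (innerTriangles (p ∘ q))ᶜ
    rw [hpq]
    split_ifs with h
    · obtain ⟨x, hx, rfl⟩ := Finset.mem_image.1 (Finset.mem_sdiff.1 h).1
      exact ⟨by rw [hg x hx]; exact hO x hx, hJ _⟩
    · exact hJ i
  · rw [Finset.sdiff_union_of_subset hqsub, Finset.image_image]
    conv_rhs => rw [← Finset.image_id (s := V)]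
    exact Finset.image_congr fun x hx => hg x hx

theorem numConvexHoles_le_card {R : Set Plane} {n s : ℕ} (hs : 0 < s)
    {p : Fin n → Plane} (hp : ∀ i, p i ∈ R) [DecidablePred fun c : (_ : Fin 4 → Fin n) ×
      Finset (Fin n) => p ∈ candidateEvent R c.1 c.2] :
    numConvexHoles (Set.range p) s
      ≤ ((candidates n s).filter fun c => p ∈ candidateEvent R c.1 c.2).card := by
  classical
  rw [numConvexHoles]
  refine (Set.ncard_le_ncard (t := (((candidates n s).filter fun c =>
    p ∈ candidateEvent R c.1 c.2).image
      fun c => (c.2 ∪ Finset.univ.image c.1).image p : Finset (Finset Plane))) ?_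
      (Finset.finite_toSet _)).trans ?_
  · rintro V ⟨hV, hcard⟩
    obtain ⟨c, hc, hpc, hcV⟩ := hV.exists_candidate hs hp hcard
    simp only [Finset.coe_image, Set.mem_image, Finset.mem_coe, Finset.mem_filter]
    exact ⟨c, ⟨hc, hpc⟩, hcV⟩
  · rw [Set.ncard_coe_finset]
    exact Finset.card_image_le

/-! ### Squares -/

theorem IsPlanarSquare.isCompact {R : Set Plane} (h : IsPlanarSquare R) : IsCompact R := by
  obtain ⟨a, u, v, -, -, -, rfl⟩ := h
  have : IsCompact ((fun z : ℝ × ℝ => a + z.1 • u + z.2 • v) ''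
      (Set.Icc (0 : ℝ) 1 ×ˢ Set.Icc (0 : ℝ) 1)) :=
    (isCompact_Icc.prod isCompact_Icc).image (by fun_prop)
  convert this using 1
  ext p
  simp only [Set.mem_ofPred_eq, Set.mem_image, Prod.exists, Set.mem_prod]
  constructor
  · rintro ⟨x, hx, y, hy, rfl⟩
    exact ⟨x, y, ⟨hx, hy⟩, rfl⟩
  · rintro ⟨x, y, ⟨hx, hy⟩, rfl⟩
    exact ⟨x, hx, y, hy, rfl⟩

theorem IsPlanarSquare.convex {R : Set Plane} (h : IsPlanarSquare R) : Convex ℝ R := by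
  obtain ⟨a, u, v, -, -, -, rfl⟩ := h
  rintro _ ⟨x, hx, y, hy, rfl⟩ _ ⟨x', hx', y', hy', rfl⟩ s t hs ht hst
  refine ⟨s * x + t * x', convex_Icc (0 : ℝ) 1 hx hx' hs ht hst, s * y + t * y',
    convex_Icc (0 : ℝ) 1 hy hy' hs ht hst, ?_⟩
  obtain rfl : s = 1 - t := by linarith
  module

theorem IsPlanarSquare.volume_ne_zero {R : Set Plane} (h : IsPlanarSquare R) :
    volume R ≠ 0 := by
  obtain ⟨a, u, v, hu, huv, horth, rfl⟩ := h
  have hu2 : 0 < u 0 ^ 2 + u 1 ^ 2 := by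
    have := pow_pos (norm_pos_iff.2 hu) 2
    simpa [EuclideanSpace.norm_sq_eq, Fin.sum_univ_two] using this
  have hn : u 0 ^ 2 + u 1 ^ 2 = v 0 ^ 2 + v 1 ^ 2 := by
    have := congrArg (· ^ 2) huv
    simpa [EuclideanSpace.norm_sq_eq, Fin.sum_univ_two] using this
  have ho : u 0 * v 0 + u 1 * v 1 = 0 := by
    simp [PiLp.inner_apply, Fin.sum_univ_two] at horth
    linarith
  set N := u 0 ^ 2 + u 1 ^ 2 with hN
  -- Lagrange's identity for orthogonal vectors of equal length.
  have hdet : (u 0 * v 1 - u 1 * v 0) ^ 2 = N ^ 2 := by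
    linear_combination -(u 0 * v 0 + u 1 * v 1) * ho - N * hn
  have hdet0 : u 0 * v 1 - u 1 * v 0 ≠ 0 := by
    intro h
    rw [h] at hdet
    nlinarith
  set D := u 0 * v 1 - u 1 * v 0 with hD
  -- The open square, with coordinates along `u` and `v` given by Cramer's rule; it contains the
  -- centre.
  let U : Set Plane :=
    {p | 0 < ((p 0 - a 0) * v 1 - (p 1 - a 1) * v 0) / D} ∩
    {p | ((p 0 - a 0) * v 1 - (p 1 - a 1) * v 0) / D < 1} ∩
    ({p | 0 < ((p 1 - a 1) * u 0 - (p 0 - a 0) * u 1) / D} ∩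
    {p | ((p 1 - a 1) * u 0 - (p 0 - a 0) * u 1) / D < 1})
  have hU : IsOpen U := by
    refine IsOpen.inter (IsOpen.inter ?_ ?_) (IsOpen.inter ?_ ?_) <;>
      exact isOpen_lt (by fun_prop) (by fun_prop)
  have hne : U.Nonempty := by
    have h1 : ((2⁻¹ * u 0 + 2⁻¹ * v 0) * v 1 - (2⁻¹ * u 1 + 2⁻¹ * v 1) * v 0) / D = 2⁻¹ := by
      field_simp
      rw [hD]
      ring
    have h2 : ((2⁻¹ * u 1 + 2⁻¹ * v 1) * u 0 - (2⁻¹ * u 0 + 2⁻¹ * v 0) * u 1) / D = 2⁻¹ := by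
      field_simp
      rw [hD]
      ring
    refine ⟨a + ((2⁻¹ : ℝ) • u + (2⁻¹ : ℝ) • v), ?_⟩
    simp only [U, Set.mem_inter_iff, Set.mem_ofPred_eq, PiLp.add_apply, PiLp.smul_apply,
      smul_eq_mul, add_sub_cancel_left, h1, h2]
    norm_num
  refine fun h0 => (hU.measure_pos volume hne).ne' (measure_mono_null ?_ h0)
  rintro p ⟨⟨h1, h2⟩, h3, h4⟩
  refine ⟨_, ⟨h1.le, h2.le⟩, _, ⟨h3.le, h4.le⟩, ?_⟩
  ext i
  fin_cases i
  · simp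
    field_simp
    rw [hD]
    ring
  · simp
    field_simp
    rw [hD]
    ring

/-! ### Markov's inequality and the conclusion -/

theorem uniformPoints_le_numConvexHoles_le {R : Set Plane} (hR : IsPlanarSquare R) {n s k : ℕ}
    (hs : 0 < s) (hk : k ≠ 0) :
    uniformPoints R n {p | k ≤ numConvexHoles (Set.range p) s} ≤ (n : ENNReal) ^ 4 / k := by
  classical
  have hRm := hR.isCompact.measurableSet
  have h0 := hR.volume_ne_zero
  have h1 := hR.isCompact.measure_ne_top (μ := volume)
  have : IsProbabilityMeasure (cond volume R) := cond_isProbabilityMeasure_of_finite h0 h1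
  -- A measurable function that almost surely dominates the number of holes, so no measurability of
  -- `numConvexHoles` is needed.
  let f : (Fin n → Plane) → ENNReal := fun p =>
    ∑ c ∈ candidates n s, (candidateEvent R c.1 c.2).indicator 1 p
  have hf : Measurable f := Finset.measurable_fun_sum _ fun c _ =>
    measurable_one.indicator (measurableSet_candidateEvent hRm c.1 c.2)
  have hint : ∫⁻ p, f p ∂uniformPoints R n ≤ (n : ENNReal) ^ 4 := by
    simp only [f]
    rw [lintegral_finsetSum _ fun c _ =>
      measurable_one.indicator (measurableSet_candidateEvent hRm c.1 c.2)]
    simp only [lintegral_indicator_one (measurableSet_candidateEvent hRm _ _)]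
    rw [candidates, Finset.sum_sigma]
    refine (Finset.sum_le_sum fun q _ =>
      sum_candidateEvent_le_one hRm q hR.convex h0 h1 _).trans ?_
    simp
  have hae : ∀ᵐ p ∂uniformPoints R n, ∀ i, p i ∈ R := by
    refine ae_all_iff.2 fun i => ?_
    exact (measurePreserving_eval (fun _ : Fin n => cond volume R) i).quasiMeasurePreserving.ae
      (ae_cond_mem hRm)
  refine (measure_mono_ae (t := {p | (k : ENNReal) ≤ f p}) ?_).trans
    ((meas_ge_le_lintegral_div hf.aemeasurable (by simpa using hk) (by simp)).trans
      (ENNReal.div_le_div_right hint _))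
  filter_upwards [hae] with p hp hkp
  have h2 := le_trans hkp (numConvexHoles_le_card (R := R) hs hp)
  change (k : ENNReal) ≤ f p
  calc (k : ENNReal) ≤ _ := Nat.cast_le.2 h2
    _ = f p := by
      simp only [f, Finset.card_filter, Nat.cast_sum, Set.indicator_apply, Nat.cast_ite,
        Nat.cast_one, Nat.cast_zero, Pi.one_apply]

theorem mainTheorem4 (R : Set Plane) (hR : IsPlanarSquare R)
    (s : ℕ → ℕ) (hs : ∀ n, 0 < s n) :
    WithHighProbability (fun n => uniformPoints R n)
      (fun n => {p : Fin n → Plane | numConvexHoles (Set.range p) (s n) ≤ n ^ 9}) := by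
  refine tendsto_of_tendsto_of_tendsto_of_le_of_le' tendsto_const_nhds
    ENNReal.tendsto_inv_nat_nhds_zero (Eventually.of_forall fun n => zero_le) ?_
  filter_upwards [eventually_gt_atTop 0] with n hn
  have hn0 : (n : ENNReal) ≠ 0 := by exact_mod_cast hn.ne'
  calc uniformPoints R n {p : Fin n → Plane | numConvexHoles (Set.range p) (s n) ≤ n ^ 9}ᶜ
      -- The threshold `n ^ 5` already gives failure probability at most `1 / n`.
      ≤ uniformPoints R n {p | n ^ 5 ≤ numConvexHoles (Set.range p) (s n)} := by
        refine measure_mono fun p hp => ?_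
        simp only [Set.mem_compl_iff, Set.mem_ofPred_eq, not_le] at hp ⊢
        exact (Nat.pow_le_pow_right hn (by norm_num)).trans hp.le
    _ ≤ (n : ENNReal) ^ 4 / (n ^ 5 : ℕ) :=
        uniformPoints_le_numConvexHoles_le hR (hs n) (pow_pos hn 5).ne'
    _ = (n : ENNReal)⁻¹ := by
        rw [Nat.cast_pow, pow_succ _ 4, ENNReal.div_eq_inv_mul,
          ENNReal.mul_inv (Or.inr (by simp)) (Or.inr hn0), mul_comm _ (n : ENNReal)⁻¹, mul_assoc,
          ENNReal.inv_mul_cancel (pow_ne_zero 4 hn0) (by simp), mul_one]
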